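/- An $\ell$-partite tournament is a finite directed graph whose vertex set can be partitioned into $\ell$ classes such that no arc joins two vertices of the same class, and any two vertices of different classes are joined by exactly one arc. Let $\delta^+(D)$ denote the minimum out-degree of a directed graph $D$. Let $k$ be a nonnegative integer and let $D$ be a $2$-partite or a $3$-partite tournament. If $\delta^+(D)\ge 2k-1$, then $D$ contains $k$ pairwise vertex-disjoint directed cycles. -/

import Mathlib

namespace Digraph

variable {V : Type*}

/-- An `ℓ`-partite tournament: the vertices are split into `ℓ` classes, no arc joins two vertices
of the same class, and any two vertices of different classes are joined by exactly one arc (in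
exactly one of the two directions). In particular there are no loops and no 2-cycles. -/
def IsPartiteTournament (D : Digraph V) (ℓ : ℕ) : Prop :=
  ∃ part : V → Fin ℓ,
    (∀ u v, part u = part v → ¬ D.Adj u v) ∧
    (∀ u v, part u ≠ part v → (D.Adj u v ↔ ¬ D.Adj v u))

/-- The out-degree of `v`: the number of vertices `w` with an arc from `v` to `w`. -/
noncomputable def outDegree (D : Digraph V) (v : V) : ℕ :=
  {w | D.Adj v w}.ncard

/-- The minimum out-degree of `D` (it is `0` for the digraph without vertices). -/
noncomputable def minOutDegree (D : Digraph V) : ℕ :=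
  ⨅ v, D.outDegree v

/-- A directed cycle of `D`: a cyclic sequence of at least two pairwise distinct vertices, with an
arc of `D` from each vertex to the cyclically next one. -/
def IsDicycle (D : Digraph V) (c : Cycle V) : Prop :=
  2 ≤ c.length ∧ c.Nodup ∧ c.Chain D.Adj

/-- `D` contains `k` pairwise vertex-disjoint directed cycles. -/
def HasDisjointDicycles (D : Digraph V) (k : ℕ) : Prop :=
  ∃ c : Fin k → Cycle V, (∀ i, D.IsDicycle (c i)) ∧
    ∀ i j, i ≠ j → ∀ v, v ∈ c i → v ∉ c j

end Digraph

namespace Digraph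

variable {V : Type*}

/-! Induct on `k`: delete a cycle meeting every out-neighbourhood at most twice, so out-degrees drop
by at most 2. Restricting to a terminal strong set keeps degrees and supplies return walks. There a
triangle works, since every vertex shares a part with one of its vertices. Without triangles,
`exists_triangle_of_walk` makes every 2-arc path end in the part where it began, which confines the
set to two parts; a vertex of minimum out-degree then lies on a 4-cycle with two vertices in each
part. -/

/-- In a 3-partite tournament, a path `u → v → w` through all three parts that is closed by a walk
from `w` to `u` forces a directed triangle. -/
theorem exists_triangle_of_walk {r : V → V → Prop} {p : V → Fin 3}
    (hne : ∀ u v, r u v → p u ≠ p v) (hasymm : ∀ u v, r u v → ¬ r v u)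
    (htot : ∀ u v, p u ≠ p v → r u v ∨ r v u) (n : ℕ) :
    ∀ (x : ℕ → V) (v : V), (∀ i < n, r (x i) (x (i + 1))) → r (x n) v → r v (x 0) →
      p (x n) ≠ p (x 0) → ∃ a b c, r a b ∧ r b c ∧ r c a := by
  classical
  induction n with
  | zero => intro x v _ _ _ h; exact absurd rfl h
  | succ n ih =>
    intro x v hx huv hvw hp
    by_contra hno
    push Not at hno
    have huw : r (x (n + 1)) (x 0) := (htot _ _ hp).resolve_right fun h => hno _ _ _ huv hvw h
    by_cases hB : ∃ j, j ≤ n + 1 ∧ p (x j) = p v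
    -- The first walk vertex in the part of `v` lets the closed walk be shortened past `v` by the
    -- arc `x (n + 1) → x 0`.
    · obtain ⟨hjn, hj⟩ := Nat.find_spec hB
      have hmin : ∀ i < Nat.find hB, p (x i) ≠ p v := fun i hi h =>
        Nat.find_min hB hi ⟨by omega, h⟩
      generalize Nat.find hB = j at hjn hj hmin
      have hj0 : j ≠ 0 := by rintro rfl; exact hne _ _ hvw hj.symm
      obtain rfl | hj1 := eq_or_ne j 1
      · obtain ⟨a, b, c, h1, h2, h3⟩ := ih (fun i => x (i + 1)) (x 0)
          (fun i hi => hx (i + 1) (by omega)) huw (hx 0 (by omega))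
          (by simpa [hj] using hne _ _ huv)
        exact hno a b c h1 h2 h3
      · obtain ⟨m, rfl⟩ : ∃ m, j = m + 2 := ⟨j - 2, by omega⟩
        -- The new path is `x m → x (m + 1) → x (m + 2)`; its return walk follows `x` to the end,
        -- jumps to `x 0` and goes on to `x m`, with `n` arcs in all.
        refine absurd (ih
          (fun i => if i ≤ n - m - 1 then x (m + 2 + i) else x (i - (n - m))) (x (m + 1))
          (fun i hi => ?_) ?_ ?_ ?_) fun ⟨a, b, c, h1, h2, h3⟩ => hno a b c h1 h2 h3
        · rcases lt_trichotomy i (n - m - 1) with h | h | h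
          · simp only [if_pos h.le, if_pos (show i + 1 ≤ n - m - 1 by omega)]
            exact hx (m + 2 + i) (by omega)
          · simp only [if_pos h.le, if_neg (show ¬ i + 1 ≤ n - m - 1 by omega)]
            rw [show m + 2 + i = n + 1 by omega, show i + 1 - (n - m) = 0 by omega]
            exact huw
          · simp only [if_neg (show ¬ i ≤ n - m - 1 by omega),
              if_neg (show ¬ i + 1 ≤ n - m - 1 by omega)]
            rw [show i + 1 - (n - m) = i - (n - m) + 1 by omega]
            exact hx _ (by omega)
        · simp only [if_neg (show ¬ n ≤ n - m - 1 by omega)]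
          rw [show n - (n - m) = m by omega]
          exact hx m (by omega)
        · simpa using hx (m + 1) (by omega)
        · simp only [if_neg (show ¬ n ≤ n - m - 1 by omega)]
          rw [show n - (n - m) = m by omega]
          simpa [hj] using hmin m (by omega)
    · push Not at hB
      -- With no triangle, domination by `v` spreads along the walk up to its end, which itself
      -- dominates `v`.
      have hdom : ∀ i ≤ n + 1, r v (x i) := by
        intro i
        induction i with
        | zero => exact fun _ => hvw
        | succ i ihi =>
          intro hi
          exact (htot _ _ (hB _ hi).symm).resolve_right fun h =>
            hno _ _ _ (ihi (by omega)) (hx i (by omega)) h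
      exact hasymm _ _ huv (hdom _ le_rfl)

theorem exists_walk_of_reflTransGen {r : V → V → Prop} {a b : V}
    (h : Relation.ReflTransGen r a b) :
    ∃ (n : ℕ) (x : ℕ → V), x 0 = a ∧ x n = b ∧ ∀ i < n, r (x i) (x (i + 1)) := by
  induction h with
  | refl => exact ⟨0, fun _ => a, rfl, rfl, by simp⟩
  | @tail b c _ hbc ih =>
    obtain ⟨n, x, h0, hn, hx⟩ := ih
    refine ⟨n + 1, fun i => if i ≤ n then x i else c, by simpa using h0, by simp, fun i hi => ?_⟩
    obtain h | rfl := (Nat.lt_succ_iff.1 hi).lt_or_eq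
    · simpa [h.le, Nat.succ_le_of_lt h] using hx i h
    · simpa [hn] using hbc

/-- A nonempty vertex set contains a nonempty subset that no arc leaves and in which any two
vertices are joined by a directed path. -/
theorem exists_terminal_strong [Finite V] (D : Digraph V) {S : Set V} (hS : S.Nonempty) :
    ∃ T ⊆ S, T.Nonempty ∧ (∀ u ∈ T, ∀ v ∈ S, D.Adj u v → v ∈ T) ∧
      ∀ u v : T, Relation.ReflTransGen (fun a b : T => D.Adj a b) u v := by
  obtain ⟨T, ⟨hTS, hT, hcl⟩, hmin⟩ := Set.Finite.exists_minimal
    (s := {T : Set V | T ⊆ S ∧ T.Nonempty ∧ ∀ u ∈ T, ∀ v ∈ S, D.Adj u v → v ∈ T})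
    (Set.toFinite _) ⟨S, subset_rfl, hS, fun _ _ v hv _ => hv⟩
  refine ⟨T, hTS, hT, hcl, fun u v => ?_⟩
  have hR := hmin (y := Subtype.val '' {w : T | Relation.ReflTransGen (fun a b : T => D.Adj a b) u w})
    ⟨?_, ⟨u, u, .refl, rfl⟩, ?_⟩ ?_
  · obtain ⟨w, hw, hwv⟩ := hR v.2
    rwa [← Subtype.ext hwv]
  · rintro _ ⟨w, -, rfl⟩
    exact hTS w.2
  · rintro _ ⟨w, hw, rfl⟩ z hz hwz
    exact ⟨⟨z, hcl _ w.2 z hz hwz⟩, .tail hw hwz, rfl⟩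
  · rintro _ ⟨w, -, rfl⟩
    exact w.2

/-- A 3-partite tournament that is strong on `T` and has positive out-degrees there has a directed
cycle in `T` that meets each out-neighbourhood at most twice. -/
theorem exists_dicycle_inter_ncard_le_two [Finite V] (D : Digraph V) {p : V → Fin 3}
    (hp : ∀ u v, p u = p v → ¬ D.Adj u v) (hp' : ∀ u v, p u ≠ p v → (D.Adj u v ↔ ¬ D.Adj v u))
    {T : Set V} (hT : T.Nonempty) (hpos : ∀ v ∈ T, ∃ w ∈ T, D.Adj v w)
    (hstrong : ∀ u v : T, Relation.ReflTransGen (fun a b : T => D.Adj a b) u v) :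
    ∃ c : Cycle V, D.IsDicycle c ∧ (∀ v ∈ c, v ∈ T) ∧
      ∀ v ∈ T, ({w | D.Adj v w} ∩ {w | w ∈ c}).ncard ≤ 2 := by
  have hne : ∀ u v, D.Adj u v → p u ≠ p v := fun u v h e => hp u v e h
  have hasymm : ∀ u v, D.Adj u v → ¬ D.Adj v u := fun u v h => (hp' u v (hne u v h)).1 h
  have htot : ∀ u v, p u ≠ p v → D.Adj u v ∨ D.Adj v u := fun u v h => by
    rw [hp' u v h]; exact (em _).symm
  have hpair : ∀ (s : Set V) (a b : V), s ⊆ {a, b} → s.ncard ≤ 2 := fun s a b h =>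
    (Set.ncard_le_ncard h (Set.toFinite _)).trans ((Set.ncard_insert_le a {b}).trans (by simp))
  by_cases htri : ∃ a b c : T, D.Adj a b ∧ D.Adj b c ∧ D.Adj c a
  · obtain ⟨a, b, c, hab, hbc, hca⟩ := htri
    have nab := hne _ _ hab
    have nbc := hne _ _ hbc
    have nca := hne _ _ hca
    refine ⟨([a.1, b.1, c.1] : List V), ⟨by simp, ?_, ?_⟩, ?_, ?_⟩
    · simp only [Cycle.nodup_coe_iff, List.nodup_cons, List.mem_cons, List.not_mem_nil, or_false,
        not_or, List.nodup_nil, not_false_eq_true, and_true]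
      exact ⟨⟨fun h => nab (by rw [h]), fun h => nca (by rw [h])⟩, fun h => nbc (by rw [h])⟩
    · simp [Cycle.chain_coe_cons, hab, hbc, hca]
    · simp
    · intro v _
      have hv : p v = p a ∨ p v = p b ∨ p v = p c := by omega
      rcases hv with h | h | h
      · refine hpair _ b.1 c.1 ?_
        rintro w ⟨hw, hwc⟩
        simp only [Set.mem_ofPred_eq, Cycle.mem_coe_iff, List.mem_cons, List.not_mem_nil,
          or_false] at hw hwc
        rcases hwc with rfl | rfl | rfl
        · exact absurd h (hne _ _ hw)
        · exact .inl rfl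
        · exact .inr rfl
      · refine hpair _ a.1 c.1 ?_
        rintro w ⟨hw, hwc⟩
        simp only [Set.mem_ofPred_eq, Cycle.mem_coe_iff, List.mem_cons, List.not_mem_nil,
          or_false] at hw hwc
        rcases hwc with rfl | rfl | rfl
        · exact .inl rfl
        · exact absurd h (hne _ _ hw)
        · exact .inr rfl
      · refine hpair _ a.1 b.1 ?_
        rintro w ⟨hw, hwc⟩
        simp only [Set.mem_ofPred_eq, Cycle.mem_coe_iff, List.mem_cons, List.not_mem_nil,
          or_false] at hw hwc
        rcases hwc with rfl | rfl | rfl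
        · exact .inl rfl
        · exact .inr rfl
        · exact absurd h (hne _ _ hw)
  · have halt : ∀ u ∈ T, ∀ v ∈ T, ∀ w ∈ T, D.Adj u v → D.Adj v w → p u = p w := by
      intro u hu v hv w hw huv hvw
      by_contra hcon
      obtain ⟨n, x, h0, hn, hx⟩ := exists_walk_of_reflTransGen (hstrong ⟨w, hw⟩ ⟨u, hu⟩)
      refine htri (exists_triangle_of_walk (r := fun a b : T => D.Adj a b) (p := fun a => p a)
        (fun a b => hne a b) (fun a b => hasymm a b) (fun a b => htot a b) n x ⟨v, hv⟩ hx ?_ ?_ ?_)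
      · simpa [hn] using huv
      · simpa [h0] using hvw
      · simpa [hn, h0] using hcon
    obtain ⟨v, hv, hmin⟩ := Set.exists_min_image T (fun v => ({w | D.Adj v w} ∩ T).ncard)
      (Set.toFinite _) hT
    obtain ⟨w, hw, hvw⟩ := hpos v hv
    obtain ⟨v', hv', hwv'⟩ := hpos w hw
    have hpv : p v = p v' := halt v hv w hw v' hv' hvw hwv'
    obtain ⟨y, ⟨hv'y, hy⟩, hvy⟩ :
        ∃ y ∈ {w | D.Adj v' w} ∩ T, y ∉ {w | D.Adj v w} ∩ T := by
      by_contra hcon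
      push Not at hcon
      have hss : {w | D.Adj v' w} ∩ T ⊂ {w | D.Adj v w} ∩ T :=
        (Set.ssubset_iff_of_subset hcon).2 ⟨w, ⟨hvw, hw⟩, fun h => hasymm _ _ hwv' h.1⟩
      exact absurd (hmin v' hv') (not_le.2 (Set.ncard_lt_ncard hss (Set.toFinite _)))
    have hv'y : D.Adj v' y := hv'y
    have hyv : D.Adj y v := (htot y v fun h => hne _ _ hv'y (hpv ▸ h.symm)).resolve_right
      fun h => hvy ⟨h, hy⟩
    have hpw : p w = p y := halt w hw v' hv' y hy hwv' hv'y
    have nvw := hne _ _ hvw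
    refine ⟨([v, w, v', y] : List V), ⟨by simp, ?_, ?_⟩, ?_, ?_⟩
    · simp only [Cycle.nodup_coe_iff, List.nodup_cons, List.mem_cons, List.not_mem_nil, or_false,
        not_or, List.nodup_nil, not_false_eq_true, and_true]
      refine ⟨⟨?_, ?_, ?_⟩, ⟨?_, ?_⟩, ?_⟩
      · rintro rfl; exact nvw rfl
      · rintro rfl; exact hasymm _ _ hvw hwv'
      · rintro rfl; exact nvw hpw.symm
      · rintro rfl; exact nvw hpv
      · rintro rfl; exact hasymm _ _ hvw hyv
      · rintro rfl; exact hne _ _ hv'y rfl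
    · simp [Cycle.chain_coe_cons, hvw, hwv', hv'y, hyv]
    · simp [hv, hw, hv', hy]
    · intro x hx
      by_cases hxv : p x = p v
      · refine hpair _ w y ?_
        rintro z ⟨hz, hzc⟩
        simp only [Set.mem_ofPred_eq, Cycle.mem_coe_iff, List.mem_cons, List.not_mem_nil,
          or_false] at hz hzc
        rcases hzc with rfl | rfl | rfl | rfl
        · exact absurd hxv (hne _ _ hz)
        · exact .inl rfl
        · exact absurd (hxv.trans hpv) (hne _ _ hz)
        · exact .inr rfl
      · have hxw : p x = p w := by
          rcases htot x v hxv with h | h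
          · exact halt x hx v hv w hw h hvw
          · exact hpw ▸ (halt y hy v hv x hx hyv h).symm
        refine hpair _ v v' ?_
        rintro z ⟨hz, hzc⟩
        simp only [Set.mem_ofPred_eq, Cycle.mem_coe_iff, List.mem_cons, List.not_mem_nil,
          or_false] at hz hzc
        rcases hzc with rfl | rfl | rfl | rfl
        · exact .inl rfl
        · exact absurd hxw (hne _ _ hz)
        · exact .inr rfl
        · exact absurd (hxw.trans hpw) (hne _ _ hz)

/-- The induction runs over vertex sets of one fixed digraph. Nonemptiness is needed separately
because the degree bound is vacuous on the empty set. -/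
theorem exists_disjoint_dicycles_of_three_partite [Finite V] (D : Digraph V) {p : V → Fin 3}
    (hp : ∀ u v, p u = p v → ¬ D.Adj u v) (hp' : ∀ u v, p u ≠ p v → (D.Adj u v ↔ ¬ D.Adj v u))
    (k : ℕ) : ∀ S : Set V, (k ≠ 0 → S.Nonempty) →
      (∀ v ∈ S, 2 * k ≤ ({w | D.Adj v w} ∩ S).ncard + 1) →
      ∃ c : Fin k → Cycle V, (∀ i, D.IsDicycle (c i)) ∧
        (∀ i j, i ≠ j → ∀ v, v ∈ c i → v ∉ c j) ∧ ∀ i, ∀ v ∈ c i, v ∈ S := by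
  induction k with
  | zero => intro S _ _; exact ⟨Fin.elim0, fun i => i.elim0, fun i => i.elim0, fun i => i.elim0⟩
  | succ k ih =>
    intro S hS hdeg
    obtain ⟨T, hTS, hT, hcl, hstrong⟩ := exists_terminal_strong D (hS k.succ_ne_zero)
    have hinter : ∀ v ∈ T, {w | D.Adj v w} ∩ S = {w | D.Adj v w} ∩ T := fun v hv =>
      Set.Subset.antisymm (fun w hw => ⟨hw.1, hcl v hv w hw.2 hw.1⟩) fun w hw => ⟨hw.1, hTS hw.2⟩
    have hdegT : ∀ v ∈ T, 2 * (k + 1) ≤ ({w | D.Adj v w} ∩ T).ncard + 1 := fun v hv =>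
      hinter v hv ▸ hdeg v (hTS hv)
    obtain ⟨c, hc, hcT, hc2⟩ := exists_dicycle_inter_ncard_le_two D hp hp' hT (fun v hv => by
      obtain ⟨w, hw⟩ := Set.nonempty_of_ncard_ne_zero
        (s := {w | D.Adj v w} ∩ T) (by have := hdegT v hv; omega)
      exact ⟨w, hw.2, hw.1⟩) hstrong
    have hdiff : ∀ v ∈ T, 2 * k ≤ ({w | D.Adj v w} ∩ (T \ {w | w ∈ c})).ncard + 1 := by
      intro v hv
      have h1 := hdegT v hv
      have h2 := hc2 v hv
      have h3 : {w | D.Adj v w} ∩ T ⊆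
          ({w | D.Adj v w} ∩ (T \ {w | w ∈ c})) ∪ ({w | D.Adj v w} ∩ {w | w ∈ c}) := by
        intro w hw
        by_cases h : w ∈ c
        · exact .inr ⟨hw.1, h⟩
        · exact .inl ⟨hw.1, hw.2, h⟩
      have h4 := (Set.ncard_le_ncard h3 (Set.toFinite _)).trans (Set.ncard_union_le _ _)
      omega
    -- For `k ≠ 0`, any vertex of `T` keeps an out-neighbour outside `c`, so the remainder is
    -- nonempty.
    obtain ⟨d, hd, hdd, hdT⟩ := ih (T \ {w | w ∈ c}) (fun hk => by
        obtain ⟨v, hv⟩ := hT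
        obtain ⟨w, hw⟩ := Set.nonempty_of_ncard_ne_zero
          (s := {w | D.Adj v w} ∩ (T \ {w | w ∈ c})) (by have := hdiff v hv; omega)
        exact ⟨w, hw.2⟩) fun v hv => hdiff v hv.1
    refine ⟨Fin.cons c d, ?_, ?_, ?_⟩
    · exact Fin.cases hc hd
    · refine Fin.cases (Fin.cases (fun h => absurd rfl h) fun j _ v hv hvj => ?_)
        fun i => Fin.cases (fun _ v hvi hv => ?_) fun j hij v => ?_
      · exact (hdT j v hvj).2 hv
      · exact (hdT i v hvi).2 hv
      · exact hdd i j (fun h => hij (h ▸ rfl)) v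
    · exact Fin.cases (fun v hv => hTS (hcT v hv)) fun i v hv => hTS (hdT i v hv).1

theorem IsPartiteTournament.mono {D : Digraph V} {m n : ℕ} (h : D.IsPartiteTournament m)
    (hmn : m ≤ n) : D.IsPartiteTournament n := by
  obtain ⟨p, h1, h2⟩ := h
  exact ⟨fun v => Fin.castLE hmn (p v), fun u v e => h1 u v (Fin.castLE_injective hmn e),
    fun u v e => h2 u v fun e' => e (congrArg _ e')⟩

end Digraph

theorem mainTheorem4 {V : Type*} [Finite V] (D : Digraph V) (k : ℕ)
    (hD : D.IsPartiteTournament 2 ∨ D.IsPartiteTournament 3)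
    (hδ : 2 * (k : ℤ) - 1 ≤ (D.minOutDegree : ℤ)) :
    D.HasDisjointDicycles k := by
  obtain ⟨p, hp, hp'⟩ : D.IsPartiteTournament 3 := hD.elim (fun h => h.mono (by norm_num)) id
  obtain ⟨c, hc, hcd, -⟩ := D.exists_disjoint_dicycles_of_three_partite hp hp' k Set.univ
    (fun hk => by
      by_contra hemp
      have : IsEmpty V := by
        rwa [← Set.nonempty_iff_univ_nonempty, not_nonempty_iff] at hemp
      -- The empty infimum is `0`, so the degree hypothesis forces `k = 0`.
      simp only [Digraph.minOutDegree, Nat.iInf_of_empty] at hδ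
      omega)
    (fun v _ => by
      have h : D.minOutDegree ≤ D.outDegree v := ciInf_le (OrderBot.bddBelow _) v
      simp only [Digraph.outDegree] at h
      rw [Set.inter_univ]
      omega)
  exact ⟨c, hc, hcd⟩
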